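/- **Advice.** An online algorithm with $k$ advice bits asks $k$ yes/no queries of the form "is the input in $S$?" about the input before it runs. Each query may depend on the answers received so far, and the received string of $k$ answers determines which deterministic online algorithm is then run. An advice bit is wrong if it is not the correct answer to the query that was asked. The competitive ratio of the algorithm under error $\eta$ is the supremum of its performance ratio over all inputs and all received strings with at most $\eta$ wrong bits. The algorithm is oblivious: it gets no information about the number of wrong bits. Error-free advice is the case $\eta=0$. **Time-series search.** Let $0<m\le M$ be known. The input is a finite non-empty sequence of prices in $[m,M]$, of unknown length. On each day the next price is revealed and the player accepts it (and the game ends) or rejects it; if no price is accepted, the last price is accepted by default. The performance ratio is the maximum price of the sequence divided by the accepted price. **Online bidding.** The input is a hidden real number $u\ge 1$. The player chooses an infinite increasing sequence $x_1<x_2<\cdots$ of positive bids. The cost is $\sum_{i\le j}x_i$, where $j$ is the least index with $x_j\ge u$ (and $\infty$ if there is none). The performance ratio is the cost divided by $u$. **Theorem.** Let $\mathcal H(p)=-p\log_2 p-(1-p)\log_2(1-p)$ be the binary entropy function. There is a $k_0$ such that for all $k\ge k_0$ and all $c\in(0,1/3)$ the following holds. Let $l$ be the number $$\frac{1}{\left(\frac23+c\right)\left(1-\mathcal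 H\left(\frac{1/3-c}{2/3+c}\right)\right)}\,k+1,$$ rounded to an integer (either up or down). For time-series search, for all $0<m\le M$, and likewise for online bidding, there is an oblivious online algorithm $A$ with $l$ advice bits such that, for every error $\eta\le(\frac13-c)\,l$, the competitive ratio of $A$ under error $\eta$ is at most the competitive ratio of every online algorithm $B$ for the same problem with $k$ error-free advice bits. -/

import Mathlib

namespace ImperfectAdvice

/-! ### Advice as answers to yes/no queries -/

/-- An online algorithm with `k` advice bits. Each advice bit is the (possibly wrong) answer to a
yes/no query about the input, i.e. to a question "does the input lie in `S`?". The query for bit `i`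
may depend on the answers received for the earlier bits. The received bit string alone decides which
online algorithm without advice is run. The structure holds no information about the number of
wrong bits. -/
structure AdviceAlgorithm (k : ℕ) (Input Alg : Type) where
  query : (i : Fin k) → (Fin i → Bool) → Set Input
  select : (Fin k → Bool) → Alg

namespace AdviceAlgorithm

variable {k : ℕ} {Input Alg : Type}

/-- The query that is asked for bit `i` if the received bit string is `r`. -/
def askedQuery (A : AdviceAlgorithm k Input Alg) (r : Fin k → Bool) (i : Fin k) : Set Input :=
  A.query i (fun j => r (Fin.castLE i.isLt.le j))

open Classical in
/-- The number of wrong bits of the received string `r` on the input `x`. -/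
noncomputable def errors (A : AdviceAlgorithm k Input Alg) (x : Input) (r : Fin k → Bool) : ℕ :=
  (Finset.univ.filter fun i : Fin k => ¬ (r i = true ↔ x ∈ A.askedQuery r i)).card

/-- The competitive ratio of `A` when up to `H` advice bits may be wrong: the worst ratio over
all inputs and all received strings with at most `H` wrong bits. Here `ratio a x` is the performance
ratio of the online algorithm `a` on the single input `x`. -/
noncomputable def competitiveRatio (ratio : Alg → Input → ENNReal)
    (A : AdviceAlgorithm k Input Alg) (H : ℕ) : ENNReal :=
  ⨆ (x : Input) (r : Fin k → Bool) (_ : A.errors x r ≤ H), ratio (A.select r) x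

end AdviceAlgorithm

/-! ### Time-series search -/

/-- A price sequence with days `0, …, last` and prices in `[m, M]`. -/
structure PriceSequence (m M : ℝ) where
  last : ℕ
  price : Fin (last + 1) → ℝ
  price_mem : ∀ i, price i ∈ Set.Icc m M

/-- A deterministic online algorithm for time-series search: on day `n` it decides, from the prices
of days `0, …, n` (and not knowing the horizon), whether to accept the current price. -/
def SellingRule : Type := (n : ℕ) → (Fin (n + 1) → ℝ) → Bool

namespace PriceSequence

variable {m M : ℝ}

/-- The prices revealed up to and including day `i`. -/
def history (σ : PriceSequence m M) (i : Fin (σ.last + 1)) : Fin ((i : ℕ) + 1) → ℝ :=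
  fun j => σ.price (Fin.castLE i.isLt j)

/-- The day of the sale: the first day whose price is accepted, or the last day if there is none. -/
def saleDay (A : SellingRule) (σ : PriceSequence m M) : Fin (σ.last + 1) :=
  (Finset.univ.filter fun i : Fin (σ.last + 1) =>
    A i (σ.history i) = true ∨ i = Fin.last σ.last).min' ⟨Fin.last σ.last, by simp⟩

def profit (A : SellingRule) (σ : PriceSequence m M) : ℝ := σ.price (σ.saleDay A)

noncomputable def maxPrice (σ : PriceSequence m M) : ℝ :=
  Finset.univ.sup' Finset.univ_nonempty σ.price

end PriceSequence

/-- The maximum price divided by the accepted price. -/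
noncomputable def timeSeriesRatio (m M : ℝ) (A : SellingRule) (σ : PriceSequence m M) : ENNReal :=
  ENNReal.ofReal (σ.maxPrice / σ.profit A)

/-! ### Online bidding -/

/-- A bidding strategy: an infinite increasing sequence of positive bids. -/
structure BiddingStrategy where
  bid : ℕ → ℝ
  bid_pos : ∀ i, 0 < bid i
  bid_strictMono : StrictMono bid

open Classical in
/-- The cost of discovering the hidden value `u`: the sum of all bids up to and including the first
bid that is at least `u`, and `∞` if no bid reaches `u`. -/
noncomputable def BiddingStrategy.cost (X : BiddingStrategy) (u : ℝ) : ENNReal :=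
  if h : ∃ j, u ≤ X.bid j then
    ENNReal.ofReal (∑ i ∈ Finset.range (Nat.find h + 1), X.bid i)
  else ⊤

/-- The discovery cost divided by the hidden value; the hidden values are the reals `u ≥ 1`. -/
noncomputable def biddingRatio (X : BiddingStrategy) (u : Set.Ici (1 : ℝ)) : ENNReal :=
  X.cost u / ENNReal.ofReal u

/-! ### The advice size -/

/-- The binary entropy function, in bits. -/
noncomputable def entropy (p : ℝ) : ℝ := Real.binEntropy p / Real.log 2

noncomputable def adviceSize (k : ℕ) (c : ℝ) : ℝ :=
  1 / ((2 / 3 + c) * (1 - entropy ((1 / 3 - c) / (2 / 3 + c)))) * k + 1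

end ImperfectAdvice

namespace ImperfectAdvice

/-! ### A code for the binary channel with feedback: the rubber method -/

namespace Rubber

/-- The receiver pushes the received letter onto its stack; if the top `r` letters are then all
`false`, these letters and the one below them are erased. -/
def step (r : ℕ) (s : List Bool) (b : Bool) : List Bool :=
  if List.replicate r false <+: b :: s then (b :: s).drop (r + 1) else b :: s

/-- The stack is an initial segment of the word `y`. -/
def agrees (y : ℕ → Bool) : List Bool → Bool
  | [] => true
  | b :: s => agrees y s && (b == y s.length)

/-- The letter that the sender of the word `y` wants to transmit: the next letter of the word if
the stack is correct, and otherwise the erasing letter `false`. -/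
def intended (y : ℕ → Bool) (s : List Bool) : Bool := agrees y s && y s.length

/-- The number of letters on the stack that differ from the letter intended. -/
def defects (y : ℕ → Bool) : List Bool → ℕ
  | [] => 0
  | b :: s => defects y s + if b = intended y s then 0 else 1

/-- The length of the longest initial segment of the word on the stack. -/
def goodLength (y : ℕ → Bool) : List Bool → ℕ
  | [] => 0
  | b :: s => if agrees y (b :: s) then s.length + 1 else goodLength y s

/-- The number of letters `false` at the top of the stack. -/
def topZeros : List Bool → ℕ
  | [] => 0
  | b :: s => if b then 0 else topZeros s + 1

/-- Every `r` consecutive letters of the word include a `true`. -/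
def Avoids (r : ℕ) (y : ℕ → Bool) : Prop := ∀ i, ∃ j < r, y (i + j) = true

variable {r : ℕ} {y : ℕ → Bool}

theorem defects_tail_le (b : Bool) (s : List Bool) : defects y s ≤ defects y (b :: s) := by
  simp [defects]

theorem defects_suffix_le {s t : List Bool} (h : s <:+ t) : defects y s ≤ defects y t := by
  obtain ⟨u, rfl⟩ := h
  induction u with
  | nil => simp
  | cons b u ih => exact ih.trans (defects_tail_le b (u ++ s))

theorem goodLength_of_agrees {s : List Bool} (h : agrees y s = true) :
    goodLength y s = s.length := by
  cases s with
  | nil => rfl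
  | cons b s => simp [goodLength, h]

theorem defects_of_agrees {s : List Bool} (h : agrees y s = true) : defects y s = 0 := by
  induction s with
  | nil => rfl
  | cons b s ih => simp_all [agrees, defects, intended]

theorem goodLength_le_length (y : ℕ → Bool) (s : List Bool) : goodLength y s ≤ s.length := by
  induction s with
  | nil => simp [goodLength]
  | cons b s ih =>
    simp only [goodLength, List.length_cons]
    split <;> omega

theorem prefix_replicate_topZeros (s : List Bool) :
    List.replicate (topZeros s) false <+: s := by
  induction s with
  | nil => simp [topZeros]
  | cons b s ih => cases b <;> simp [topZeros, List.replicate_succ, ih]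

theorem topZeros_lt {s : List Bool} (h : ¬ List.replicate r false <:+: s) : topZeros s < r := by
  by_contra! hr
  refine h (List.IsPrefix.isInfix (List.IsPrefix.trans ?_ (prefix_replicate_topZeros s)))
  obtain ⟨m, hm⟩ := Nat.exists_eq_add_of_le hr
  exact ⟨List.replicate m false, by rw [hm, List.replicate_add]⟩

theorem not_infix_step {s : List Bool} (h : ¬ List.replicate r false <:+: s)
    (b : Bool) : ¬ List.replicate r false <:+: step r s b := by
  unfold step
  split
  · rw [List.drop_succ_cons]
    exact fun h' => h (h'.trans (List.drop_suffix _ _).isInfix)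
  · rename_i h'
    rw [List.infix_cons_iff]
    tauto

theorem apply_eq_false_of_defects_eq (m : ℕ) {t : List Bool} (ht : agrees y t = true)
    (h : defects y (List.replicate m false ++ t) = defects y t) :
    agrees y (List.replicate m false ++ t) = true ∧ ∀ j < m, y (t.length + j) = false := by
  induction m with
  | zero => simpa using ht
  | succ m ih =>
    rw [List.replicate_succ, List.cons_append] at h ⊢
    have h1 := defects_suffix_le (y := y) (List.suffix_append (List.replicate m false) t)
    have h2 : defects y (List.replicate m false ++ t) = defects y t := by
      simp only [defects] at h
      omega
    obtain ⟨h3, h4⟩ := ih h2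
    have h5 : y (t.length + m) = false := by
      simp only [defects, h2, intended, h3] at h
      simp at h
      rw [add_comm]
      exact h
    refine ⟨by simp [agrees, h3, add_comm m, h5], fun j hj => ?_⟩
    rcases Nat.lt_succ_iff_lt_or_eq.1 hj with hj | rfl
    · exact h4 j hj
    · exact h5

/-- Every erasure removes a letter that was received wrongly. -/
theorem defects_drop_lt (hr : 0 < r) (hy : Avoids r y) {s : List Bool} {b : Bool}
    (hs : ¬ List.replicate r false <:+: s) (h : List.replicate r false <+: b :: s) :
    defects y ((b :: s).drop (r + 1)) < defects y (b :: s) := by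
  obtain ⟨t, ht⟩ := h
  have hdrop : (b :: s).drop (r + 1) = t.drop 1 := by
    rw [← ht, List.drop_append]
    simp
  have hle := defects_suffix_le (y := y) (List.drop_suffix (r + 1) (b :: s))
  refine lt_of_le_of_ne hle fun heq => ?_
  rw [hdrop, ← ht] at heq
  have h1 := defects_suffix_le (y := y) (List.suffix_append (List.replicate r false) t)
  have h2 := defects_suffix_le (y := y) (List.drop_suffix 1 t)
  have key : agrees y t = true → False := fun hag => by
    obtain ⟨-, h3⟩ := apply_eq_false_of_defects_eq r hag (by omega)
    obtain ⟨j, hj, hj'⟩ := hy t.length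
    simp [h3 j hj] at hj'
  cases t with
  | nil => exact key rfl
  | cons c u =>
    have h3 : defects y (c :: u) = defects y u := by
      simp only [List.drop_one, List.tail_cons] at h2 heq
      omega
    have h4 : c = intended y u := by
      by_contra hne
      simp [defects, hne] at h3
    cases hu : agrees y u with
    | true => exact key (by simp [agrees, hu, h4, intended])
    | false =>
      have hc : c = false := by simp [h4, intended, hu]
      obtain ⟨m, rfl⟩ := Nat.exists_eq_add_of_lt hr
      rw [zero_add, List.replicate_succ, List.cons_append, List.cons.injEq] at ht
      refine hs ⟨[], u, ?_⟩
      rw [zero_add, List.replicate_succ', ← ht.2, hc]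
      simp

theorem length_le_of_not_agrees {s : List Bool} (hs : ¬ List.replicate r false <:+: s)
    (h : agrees y s = false) :
    s.length + r ≤ goodLength y s + r * defects y s + topZeros s + 1 := by
  induction s with
  | nil => simp [agrees] at h
  | cons b s ih =>
    have hs' : ¬ List.replicate r false <:+: s := fun h' => hs (List.infix_cons h')
    have hz := topZeros_lt hs'
    have hgl : goodLength y (b :: s) = goodLength y s := by simp [goodLength, h]
    rw [hgl]
    cases hag : agrees y s with
    | true =>
      have hne : b ≠ intended y s := by
        rintro rfl
        simp [agrees, hag, intended] at h
      simp only [defects, hne, defects_of_agrees hag, goodLength_of_agrees hag, if_false,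
        List.length_cons]
      omega
    | false =>
      have := ih hs' hag
      by_cases hb : b = intended y s
      · have hb' : b = false := by simp [hb, intended, hag]
        have hd : defects y (b :: s) = defects y s := by simp [defects, if_pos hb]
        have ht : topZeros (b :: s) = topZeros s + 1 := by simp [topZeros, hb']
        rw [hd, ht, List.length_cons]
        omega
      · simp only [defects, if_neg hb, List.length_cons, mul_add]
        omega

theorem length_le_goodLength_add {s : List Bool}
    (hs : ¬ List.replicate r false <:+: s) :
    s.length ≤ goodLength y s + r * defects y s := by
  cases h : agrees y s with
  | true => simp [goodLength_of_agrees h]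
  | false =>
    have h1 := length_le_of_not_agrees hs h
    have h2 := topZeros_lt hs
    omega

theorem eq_of_lt_goodLength {y' : ℕ → Bool} {s : List Bool} {j : ℕ} (h : j < goodLength y s)
    (h' : j < goodLength y' s) : y j = y' j := by
  induction s with
  | nil => simp [goodLength] at h
  | cons b s ih =>
    have h1 : ∀ z : ℕ → Bool, agrees z (b :: s) = true →
        goodLength z s = s.length ∧ b = z s.length := fun z hz => by
      simp only [agrees, Bool.and_eq_true, beq_iff_eq] at hz
      exact ⟨goodLength_of_agrees hz.1, hz.2⟩
    have h2 := goodLength_le_length y s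
    have h3 := goodLength_le_length y' s
    simp only [goodLength] at h h'
    split at h <;> split at h'
    · rename_i ha ha'
      rcases Nat.lt_succ_iff_lt_or_eq.1 h with hj | rfl
      · exact ih (by rw [(h1 y ha).1]; exact hj) (by rw [(h1 y' ha').1]; exact hj)
      · rw [← (h1 y ha).2, ← (h1 y' ha').2]
    · rename_i ha _
      exact ih (by rw [(h1 y ha).1]; omega) h'
    · rename_i _ ha'
      exact ih h (by rw [(h1 y' ha').1]; omega)
    · exact ih h h'

/-- The stack after the first `t` letters of `w` have been received. -/
def stack (r : ℕ) (w : ℕ → Bool) : ℕ → List Bool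
  | 0 => []
  | t + 1 => step r (stack r w t) (w t)

theorem stack_congr {w w' : ℕ → Bool} {t : ℕ} (h : ∀ j < t, w j = w' j) :
    stack r w t = stack r w' t := by
  induction t with
  | zero => rfl
  | succ t ih =>
    rw [stack, stack, ih fun j hj => h j (hj.trans t.lt_succ_self), h t t.lt_succ_self]

theorem not_infix_stack (hr : 0 < r) (w : ℕ → Bool) (t : ℕ) :
    ¬ List.replicate r false <:+: stack r w t := by
  induction t with
  | zero => simp [stack, hr.ne']
  | succ t ih => exact not_infix_step ih (w t)

/-- The number of wrong letters among the first `t` letters of `w` if `y` is being sent. -/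
def wrongLetters (r : ℕ) (y w : ℕ → Bool) (t : ℕ) : ℕ :=
  ((Finset.range t).filter fun j => w j ≠ intended y (stack r w j)).card

theorem wrongLetters_succ (y w : ℕ → Bool) (t : ℕ) :
    wrongLetters r y w (t + 1) =
      wrongLetters r y w t + if w t = intended y (stack r w t) then 0 else 1 := by
  unfold wrongLetters
  rw [Finset.range_add_one, Finset.filter_insert]
  by_cases h : w t = intended y (stack r w t) <;> simp [h]

theorem add_defects_le (hr : 0 < r) (hy : Avoids r y) (w : ℕ → Bool) (t : ℕ) :
    t + (r + 1) * defects y (stack r w t) ≤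
      (stack r w t).length + (r + 1) * wrongLetters r y w t := by
  induction t with
  | zero => simp [stack, defects]
  | succ t ih =>
    have hpush : t + 1 + (r + 1) * defects y (w t :: stack r w t) ≤
        (w t :: stack r w t).length + (r + 1) * wrongLetters r y w (t + 1) := by
      rw [wrongLetters_succ]
      simp only [defects, List.length_cons, mul_add]
      omega
    simp only [stack, step]
    split
    · rename_i h
      have h1 := defects_drop_lt hr hy (not_infix_stack hr w t) h
      have h2 : (r + 1) * (defects y ((w t :: stack r w t).drop (r + 1)) + 1) ≤
          (r + 1) * defects y (w t :: stack r w t) := Nat.mul_le_mul_left _ h1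
      rw [List.length_drop]
      rw [mul_add, mul_one] at h2
      omega
    · exact hpush

theorem le_goodLength_stack (hr : 0 < r) (hy : Avoids r y) {w : ℕ → Bool} {t L E : ℕ}
    (ht : L + (r + 1) * E ≤ t) (hE : wrongLetters r y w t ≤ E) :
    L ≤ goodLength y (stack r w t) := by
  have h1 := add_defects_le hr hy w t
  have h2 := length_le_goodLength_add (y := y) (not_infix_stack hr w t)
  have h3 : (r + 1) * wrongLetters r y w t ≤ (r + 1) * E := Nat.mul_le_mul_left _ hE
  have h4 : (r + 1) * defects y (stack r w t) =
    r * defects y (stack r w t) + defects y (stack r w t) := by ring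
  omega

/-- A received string of finite length, padded. -/
def pad {l : ℕ} (w : Fin l → Bool) (j : ℕ) : Bool := if h : j < l then w ⟨j, h⟩ else false

theorem pad_of_lt {l : ℕ} (w : Fin l → Bool) {j : ℕ} (h : j < l) : pad w j = w ⟨j, h⟩ :=
  dif_pos h

end Rubber

open Rubber in
/-- With words avoiding `r` consecutive letters `false` and distinguished by their first `L`
letters, `L + (r + 1) * E` transmissions suffice to correct `E` errors. -/
theorem exists_feedback_code {ι : Type*} [Nonempty ι] {r l L E : ℕ} (hr : 0 < r)
    (y : ι → ℕ → Bool) (hy : ∀ x, Avoids r (y x))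
    (hinj : ∀ x x', (∀ j < L, y x j = y x' j) → x = x') (hl : L + (r + 1) * E ≤ l) :
    ∃ (send : (i : Fin l) → (Fin i → Bool) → ι → Bool) (decode : (Fin l → Bool) → ι),
      ∀ (x : ι) (w : Fin l → Bool),
        (Finset.univ.filter fun i : Fin l =>
          w i ≠ send i (fun j => w (Fin.castLE i.isLt.le j)) x).card ≤ E → decode w = x := by
  classical
  refine ⟨fun i h x => intended (y x) (stack r (pad h) i),
    fun w => if h : ∃ x, L ≤ goodLength (y x) (stack r (pad w) l) then h.choose
      else Classical.arbitrary ι, fun x w hw => ?_⟩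
  have hx : L ≤ goodLength (y x) (stack r (pad w) l) := by
    refine le_goodLength_stack hr (hy x) hl (le_trans ?_ hw)
    unfold wrongLetters
    rw [← Finset.card_map Fin.valEmbedding]
    refine Finset.card_le_card fun j hj => ?_
    simp only [Finset.mem_filter, Finset.mem_range] at hj
    obtain ⟨hjl, hj⟩ := hj
    refine Finset.mem_map.2 ⟨⟨j, hjl⟩, ?_, rfl⟩
    simp only [Finset.mem_filter, Finset.mem_univ, true_and]
    have h1 : stack r (pad fun i : Fin j => w (Fin.castLE hjl.le i)) j = stack r (pad w) j :=
      stack_congr fun i hi => by rw [pad_of_lt _ hi, pad_of_lt _ (hi.trans hjl)]; rfl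
    rwa [pad_of_lt _ hjl, ← h1] at hj
  have hex : ∃ x, L ≤ goodLength (y x) (stack r (pad w) l) := ⟨x, hx⟩
  simp only [dif_pos hex]
  exact hinj _ _ fun j hj =>
    eq_of_lt_goodLength (hj.trans_le hex.choose_spec) (hj.trans_le hx)

namespace Rubber

/-- The word consisting of `m` letters `false`, one `true` and the word `y`. -/
def prepend (m : ℕ) (y : ℕ → Bool) (j : ℕ) : Bool :=
  if j < m then false else if j = m then true else y (j - m - 1)

theorem prepend_add (m : ℕ) (y : ℕ → Bool) (j : ℕ) : prepend m y (m + 1 + j) = y j := by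
  unfold prepend
  rw [if_neg (by omega), if_neg (by omega)]
  congr 1
  omega

theorem Avoids.prepend {r m : ℕ} {y : ℕ → Bool} (hy : Avoids r y) (hm : m < r) :
    Avoids r (prepend m y) := fun i => by
  rcases le_or_gt i m with h | h
  · exact ⟨m - i, by omega, by simp [Rubber.prepend, Nat.add_sub_of_le h]⟩
  · obtain ⟨j, hj, hj'⟩ := hy (i - m - 1)
    refine ⟨j, hj, ?_⟩
    rw [← hj', ← prepend_add m y]
    congr 1
    omega

/-- There are at least `x ^ L` words of length `L` without `r` consecutive letters `false`. -/
theorem exists_words {r : ℕ} {x : ℝ} (hx0 : 0 < x) (hx2 : x ≤ 2)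
    (hx : x ^ r ≤ ∑ i ∈ Finset.range r, x ^ i) (L : ℕ) :
    ∃ T : Finset (ℕ → Bool), (∀ y ∈ T, Avoids r y) ∧
      (∀ y ∈ T, ∀ y' ∈ T, (∀ j < L, y j = y' j) → y = y') ∧ x ^ L ≤ T.card := by
  classical
  induction L using Nat.strong_induction_on with
  | _ L ih =>
  rcases lt_or_ge L r with hL | hL
  · let f : (Fin L → Bool) → ℕ → Bool := fun w j => if h : j < L then w ⟨j, h⟩ else true
    have hf : Function.Injective f := fun w w' h => by
      funext j
      have := congrFun h j
      simpa [f] using this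
    refine ⟨Finset.univ.image f, ?_, ?_, ?_⟩
    · simp only [Finset.mem_image, Finset.mem_univ, true_and, forall_exists_index]
      rintro _ w rfl i
      exact ⟨r - 1, by omega, dif_neg (by omega)⟩
    · simp only [Finset.mem_image, Finset.mem_univ, true_and, forall_exists_index]
      rintro _ w rfl _ w' rfl h
      funext j
      by_cases hj : j < L
      · exact h j hj
      · simp [f, hj]
    · rw [Finset.card_image_of_injective _ hf]
      simp only [Finset.card_univ, Fintype.card_fun, Fintype.card_bool, Fintype.card_fin]
      push_cast
      exact pow_le_pow_left₀ hx0.le hx2 L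
  · have hprev : ∀ m : ℕ, ∃ T : Finset (ℕ → Bool), m < r → (∀ y ∈ T, Avoids r y) ∧
        (∀ y ∈ T, ∀ y' ∈ T, (∀ j < L - 1 - m, y j = y' j) → y = y') ∧
        x ^ (L - 1 - m) ≤ T.card := fun m => by
      by_cases hm : m < r
      · obtain ⟨T, hT⟩ := ih (L - 1 - m) (by omega)
        exact ⟨T, fun _ => hT⟩
      · exact ⟨∅, fun h => absurd h hm⟩
    choose T hT using hprev
    have hdisj : ∀ m m' : ℕ, m < r → m' < r → ∀ y y' : ℕ → Bool,
        (∀ j < L, prepend m y j = prepend m' y' j) → m = m' := by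
      intro m m' hm hm' y y' h
      rcases lt_trichotomy m m' with h1 | h1 | h1
      · have := h m (by omega)
        simp [prepend, h1] at this
      · exact h1
      · have := h m' (by omega)
        simp [prepend, h1] at this
    have hinj : ∀ m : ℕ, m < r → ∀ y ∈ T m, ∀ y' ∈ T m,
        (∀ j < L, prepend m y j = prepend m y' j) → y = y' := by
      intro m hm y hy y' hy' h
      refine (hT m hm).2.1 y hy y' hy' fun j hj => ?_
      have := h (m + 1 + j) (by omega)
      rwa [prepend_add, prepend_add] at this
    refine ⟨(Finset.range r).biUnion fun m => (T m).image (prepend m), ?_, ?_, ?_⟩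
    · simp only [Finset.mem_biUnion, Finset.mem_range, Finset.mem_image]
      rintro _ ⟨m, hm, y, hy, rfl⟩
      exact ((hT m hm).1 y hy).prepend hm
    · simp only [Finset.mem_biUnion, Finset.mem_range, Finset.mem_image]
      rintro _ ⟨m, hm, y, hy, rfl⟩ _ ⟨m', hm', y', hy', rfl⟩ h
      obtain rfl := hdisj m m' hm hm' y y' h
      rw [hinj m hm y hy y' hy' h]
    · rw [Finset.card_biUnion]
      · push_cast
        obtain ⟨d, rfl⟩ := Nat.exists_eq_add_of_le hL
        calc x ^ (r + d) = x ^ d * x ^ r := by ring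
          _ ≤ x ^ d * ∑ i ∈ Finset.range r, x ^ i :=
            mul_le_mul_of_nonneg_left hx (by positivity)
          _ = x ^ d * ∑ i ∈ Finset.range r, x ^ (r - 1 - i) := by
            rw [Finset.sum_range_reflect (fun i => x ^ i) r]
          _ = ∑ i ∈ Finset.range r, x ^ (r + d - 1 - i) := by
            rw [Finset.mul_sum]
            refine Finset.sum_congr rfl fun i hi => ?_
            have := Finset.mem_range.1 hi
            rw [← pow_add]
            congr 1
            omega
          _ ≤ _ := by
            refine Finset.sum_le_sum fun m hm => ?_
            have hm := Finset.mem_range.1 hm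
            rw [Finset.card_image_of_injOn]
            · exact (hT m hm).2.2
            · intro y hy y' hy' h
              exact hinj m hm y hy y' hy' fun j _ => congrFun h j
      · intro m hm m' hm' hne
        rw [Function.onFun, Finset.disjoint_left]
        simp only [Finset.mem_image, not_exists, not_and]
        rintro _ ⟨y, -, rfl⟩ y' - h
        exact hne (hdisj m m' (Finset.mem_range.1 hm) (Finset.mem_range.1 hm') y y'
          fun j _ => congrFun h.symm j)

end Rubber

/-! ### The entropy bound -/

section EntropyBound

open Real

theorem pow_le_geom_sum {r : ℕ} {x : ℝ} (hx : 1 < x) (h : 1 ≤ x ^ r * (2 - x)) :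
    x ^ r ≤ ∑ i ∈ Finset.range r, x ^ i := by
  rw [geom_sum_eq hx.ne', le_div_iff₀ (by linarith)]
  linarith

/-- The growth rate of the code used: a lower bound for the growth rate of the number of words
without `r` consecutive letters `false`. -/
noncomputable def growth (r : ℕ) : ℝ := 2 * (1 - 4 / 5 * (1 / 2) ^ r)

theorem half_pow_le {r : ℕ} (hr : 2 ≤ r) : (1 / 2 : ℝ) ^ r ≤ 1 / 4 := by
  calc (1 / 2 : ℝ) ^ r ≤ (1 / 2) ^ 2 := pow_le_pow_of_le_one (by norm_num) (by norm_num) hr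
    _ = 1 / 4 := by norm_num

theorem mul_half_pow_le {r : ℕ} (hr : 3 ≤ r) : r * (1 / 2 : ℝ) ^ r ≤ 3 / 8 := by
  induction r, hr using Nat.le_induction with
  | base => norm_num
  | succ r hr ih =>
    have h1 : (1 : ℝ) ≤ r := by exact_mod_cast (by omega : 1 ≤ r)
    have h2 : (0 : ℝ) ≤ (1 / 2) ^ r := by positivity
    rw [pow_succ]
    push_cast
    nlinarith

theorem one_lt_growth {r : ℕ} (hr : 2 ≤ r) : 1 < growth r := by
  have := half_pow_le hr
  unfold growth
  linarith

theorem growth_le_two (r : ℕ) : growth r ≤ 2 := by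
  have : (0 : ℝ) ≤ (1 / 2) ^ r := by positivity
  unfold growth
  linarith

theorem growth_pow_le {r : ℕ} (hr : 2 ≤ r) :
    growth r ^ r ≤ ∑ i ∈ Finset.range r, growth r ^ i := by
  refine pow_le_geom_sum (one_lt_growth hr) ?_
  rcases hr.eq_or_lt with rfl | hr
  · norm_num [growth]
  · have h1 := mul_half_pow_le hr
    have h2 := half_pow_le hr.le
    have h3 : (0 : ℝ) < (1 / 2) ^ r := by positivity
    have h4 := one_add_mul_le_pow (a := -(4 / 5 * (1 / 2 : ℝ) ^ r)) (by linarith) r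
    have h5 : (2 : ℝ) ^ r * (1 / 2) ^ r = 1 := by rw [← mul_pow]; norm_num
    calc (1 : ℝ) ≤ 8 / 5 * (1 + r * -(4 / 5 * (1 / 2 : ℝ) ^ r)) := by linarith
      _ ≤ 8 / 5 * (1 + -(4 / 5 * (1 / 2 : ℝ) ^ r)) ^ r := by linarith
      _ = 8 / 5 * (2 ^ r * (1 / 2) ^ r) * (1 + -(4 / 5 * (1 / 2 : ℝ) ^ r)) ^ r := by
        rw [h5, mul_one]
      _ = growth r ^ r * (2 - growth r) := by
        unfold growth
        rw [mul_pow, ← sub_eq_add_neg]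
        ring

theorem log_growth {r : ℕ} (hr : 2 ≤ r) :
    log (growth r) = log 2 + log (1 - 4 / 5 * (1 / 2) ^ r) := by
  have := half_pow_le hr
  exact log_mul two_ne_zero (by linarith)

theorem binEntropy_half_pow (m : ℕ) :
    binEntropy ((1 / 2) ^ m) =
      (1 / 2) ^ m * (m * log 2) - (1 - (1 / 2) ^ m) * log (1 - (1 / 2) ^ m) := by
  rw [binEntropy, log_inv, log_inv, log_pow, one_div, log_inv]
  ring

theorem entropy_chord_right {r : ℕ} (hr : 2 ≤ r) :
    log 2 - (1 - r * (1 / 2) ^ r) * log (growth r) ≤ binEntropy ((1 / 2) ^ r) := by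
  rw [log_growth hr, binEntropy_half_pow]
  set s : ℝ := (1 / 2) ^ r with hs
  have h1 : s ≤ 1 / 4 := half_pow_le hr
  have h2 : 0 < s := by positivity
  have h3 : r * s ≤ 1 := by
    rcases hr.eq_or_lt with rfl | hr
    · norm_num [hs]
    · linarith [mul_half_pow_le hr]
  have h4 : log (1 - s) ≤ log (1 - 4 / 5 * s) := log_le_log (by linarith) (by linarith)
  have h5 : log (1 - 4 / 5 * s) ≤ 0 := log_nonpos (by linarith) (by linarith)
  have hr' : (2 : ℝ) ≤ r := by exact_mod_cast hr
  have h6 : (1 - s) * log (1 - s) ≤ (1 - s) * log (1 - 4 / 5 * s) :=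
    mul_le_mul_of_nonneg_left h4 (by linarith)
  have h7 : (1 - s) * log (1 - 4 / 5 * s) ≤ (1 - r * s) * log (1 - 4 / 5 * s) :=
    mul_le_mul_of_nonpos_right (by nlinarith) h5
  linarith

theorem entropy_chord_left {r : ℕ} (hr : 2 ≤ r) :
    log 2 - (1 - r * (1 / 2) ^ (r + 1)) * log (growth r) ≤ binEntropy ((1 / 2) ^ (r + 1)) := by
  rw [log_growth hr, binEntropy_half_pow, pow_succ]
  set s : ℝ := (1 / 2) ^ r with hs
  have h1 : s ≤ 1 / 4 := half_pow_le hr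
  have h2 : 0 < s := by positivity
  have hr' : (2 : ℝ) ≤ r := by exact_mod_cast hr
  have h3 : (1 - s * (1 / 2)) * log (1 - s * (1 / 2)) ≤ -(s / 2) * (1 - s / 2) := by
    have := log_le_sub_one_of_pos (show 0 < 1 - s * (1 / 2) by linarith)
    nlinarith
  have h4 : -(4 / 5 * s) ≤ (1 - 4 / 5 * s) * log (1 - 4 / 5 * s) := by
    have h := one_sub_inv_le_log_of_pos (show 0 < 1 - 4 / 5 * s by linarith)
    have h' := mul_le_mul_of_nonneg_left h (show 0 ≤ 1 - 4 / 5 * s by linarith)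
    rw [mul_sub, mul_inv_cancel₀ (by linarith)] at h'
    linarith
  have h5 : log (1 - 4 / 5 * s) ≤ 0 := log_nonpos (by linarith) (by linarith)
  have h6 : (1 - s) * log (1 - 4 / 5 * s) ≤ (1 - r * (s * (1 / 2))) * log (1 - 4 / 5 * s) :=
    mul_le_mul_of_nonpos_right (by nlinarith) h5
  have h7 : (1 - 1 / 5 * s) * ((1 - 4 / 5 * s) * log (1 - 4 / 5 * s)) ≤
      (1 - s) * log (1 - 4 / 5 * s) := by
    rw [← mul_assoc]
    exact mul_le_mul_of_nonpos_right (by nlinarith) h5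
  have h8 : (1 - 1 / 5 * s) * -(4 / 5 * s) ≤
      (1 - 1 / 5 * s) * ((1 - 4 / 5 * s) * log (1 - 4 / 5 * s)) :=
    mul_le_mul_of_nonneg_left h4 (by linarith)
  have h9 := log_two_gt_d9
  have h10 : -(s / 2) * (1 - s / 2) ≤ s / 2 * log 2 + (1 - 1 / 5 * s) * -(4 / 5 * s) := by
    nlinarith
  push_cast
  nlinarith

theorem entropy_chord {r : ℕ} {a b p : ℝ} (ha : 0 ≤ a) (hb : b ≤ 1) (hp : p ∈ Set.Icc a b) (z : ℝ)
    (hl : log 2 - (1 - r * a) * z ≤ binEntropy a) (hr : log 2 - (1 - r * b) * z ≤ binEntropy b) :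
    log 2 - (1 - r * p) * z ≤ binEntropy p := by
  have hab : a ≤ b := hp.1.trans hp.2
  have hlin : ConcaveOn ℝ (Set.Icc (0 : ℝ) 1) fun q : ℝ => (1 - r * q) * z - log 2 :=
    ⟨convex_Icc 0 1, fun x _ y _ s t _ _ hst => by
      obtain rfl : s = 1 - t := by linarith
      simp only [smul_eq_mul]
      linarith⟩
  have h := (strictConcave_binEntropy.concaveOn.add hlin).min_le_of_mem_Icc
    ⟨ha, hab.trans hb⟩ ⟨ha.trans hab, hb⟩ hp
  simp only [Pi.add_apply] at h
  have h' : 0 ≤ min (binEntropy a + ((1 - r * a) * z - log 2))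
    (binEntropy b + ((1 - r * b) * z - log 2)) := le_min (by linarith) (by linarith)
  linarith

theorem exists_growth_ge {p : ℝ} (hp0 : 0 < p) (hp : p ≤ 1 / 2) :
    ∃ r : ℕ, 2 ≤ r ∧ r * p ≤ 1 ∧ log 2 - (1 - r * p) * log (growth r) ≤ binEntropy p := by
  rcases le_or_gt (1 / 8) p with h | h
  · refine ⟨2, le_rfl, by push_cast; linarith, ?_⟩
    refine entropy_chord (a := 1 / 8) (b := 1 / 2) (by norm_num) (by norm_num) ⟨h, hp⟩ _ ?_ ?_
    · have := entropy_chord_left (le_refl 2)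
      norm_num at this ⊢
      exact this
    · rw [one_div, binEntropy_two_inv]
      norm_num
  · obtain ⟨n, h1, h2⟩ := exists_nat_pow_near_of_lt_one hp0 (by linarith)
      (by norm_num : (0 : ℝ) < 1 / 2) (by norm_num)
    have hn : 3 ≤ n := by
      by_contra! hn
      have : (1 / 2 : ℝ) ^ 3 ≤ (1 / 2) ^ (n + 1) :=
        pow_le_pow_of_le_one (by norm_num) (by norm_num) (by omega)
      norm_num at this
      norm_num at h1
      linarith
    refine ⟨n, by omega, ?_, ?_⟩
    · have h3 := mul_half_pow_le hn
      have h4 : (n : ℝ) * p ≤ n * (1 / 2) ^ n := mul_le_mul_of_nonneg_left h2 (Nat.cast_nonneg n)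
      linarith
    · exact entropy_chord (by positivity) ((half_pow_le (by omega)).trans (by norm_num))
        ⟨h1.le, h2⟩ _ (entropy_chord_left (by omega)) (entropy_chord_right (by omega))

/-- If `l` is the advice size, rounded in either direction, then there are `2 ^ k` words that make up
a code correcting the errors allowed. -/
theorem exists_code_parameters {k l : ℕ} {c : ℝ} (hc : c ∈ Set.Ioo (0 : ℝ) (1 / 3))
    (hl : adviceSize k c - 1 ≤ l) :
    ∃ r : ℕ, 2 ≤ r ∧ (r + 1) * ⌊(1 / 3 - c) * l⌋₊ ≤ l ∧
      (2 : ℝ) ^ k ≤ growth r ^ (l - (r + 1) * ⌊(1 / 3 - c) * l⌋₊) := by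
  obtain ⟨hc0, hc1⟩ := hc
  set p : ℝ := (1 / 3 - c) / (2 / 3 + c) with hp
  have hq : 0 < 2 / 3 + c := by linarith
  have hp0 : 0 < p := div_pos (by linarith) hq
  have hp1 : p < 1 / 2 := by rw [hp, div_lt_iff₀ hq]; linarith
  have hpq : (2 / 3 + c) * p = 1 / 3 - c := by rw [hp]; field_simp
  obtain ⟨r, hr, hrp, hent⟩ := exists_growth_ge hp0 hp1.le
  set E := ⌊(1 / 3 - c) * l⌋₊ with hE
  have hl0 : (0 : ℝ) ≤ l := Nat.cast_nonneg l
  have hE' : (E : ℝ) ≤ (1 / 3 - c) * l := Nat.floor_le (mul_nonneg (by linarith) hl0)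
  have hr0 : (0 : ℝ) ≤ r := Nat.cast_nonneg r
  have hlen : (2 / 3 + c) * (1 - r * p) * l ≤ l - (r + 1) * E := by
    have : ((r : ℝ) + 1) * E ≤ (r + 1) * ((1 / 3 - c) * l) :=
      mul_le_mul_of_nonneg_left hE' (by linarith)
    have h' : (2 / 3 + c) * (1 - r * p) = 1 - (r + 1) * (1 / 3 - c) := by
      linear_combination (-(r : ℝ)) * hpq
    rw [h']
    linarith
  have hle : (r + 1) * E ≤ l := by
    have h0 : 0 ≤ (2 / 3 + c) * (1 - r * p) * l :=
      mul_nonneg (mul_nonneg hq.le (by linarith)) hl0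
    have : (((r + 1) * E : ℕ) : ℝ) ≤ l := by push_cast; linarith
    exact_mod_cast this
  refine ⟨r, hr, hle, ?_⟩
  have hlog2 : 0 < log 2 := log_pos one_lt_two
  have hlt : binEntropy p < log 2 := binEntropy_lt_log_two.2 (by rw [← one_div]; exact hp1.ne)
  have hH : 1 - entropy p = (log 2 - binEntropy p) / log 2 := by
    unfold entropy
    field_simp
  have hk : (k : ℝ) * log 2 ≤ (2 / 3 + c) * (log 2 - binEntropy p) * l := by
    have hpos : 0 < (2 / 3 + c) * ((log 2 - binEntropy p) / log 2) :=
      mul_pos hq (div_pos (by linarith) hlog2)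
    unfold adviceSize at hl
    rw [← hp, hH, add_sub_cancel_right, one_div, inv_mul_le_iff₀ hpos] at hl
    calc (k : ℝ) * log 2 ≤ (2 / 3 + c) * ((log 2 - binEntropy p) / log 2) * l * log 2 :=
        mul_le_mul_of_nonneg_right hl hlog2.le
      _ = _ := by field_simp
  have hgrow := one_lt_growth hr
  have hlg : 0 < log (growth r) := log_pos hgrow
  rw [← log_le_log_iff (by positivity) (by positivity), log_pow, log_pow, Nat.cast_sub hle]
  push_cast
  calc (k : ℝ) * log 2 ≤ (2 / 3 + c) * (log 2 - binEntropy p) * l := hk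
    _ ≤ (2 / 3 + c) * ((1 - r * p) * log (growth r)) * l := by
      refine mul_le_mul_of_nonneg_right (mul_le_mul_of_nonneg_left ?_ hq.le) hl0
      linarith
    _ = (2 / 3 + c) * (1 - r * p) * l * log (growth r) := by ring
    _ ≤ _ := mul_le_mul_of_nonneg_right hlen hlg.le

end EntropyBound

/-! ### From error-free to robust advice -/

namespace AdviceAlgorithm

variable {k : ℕ} {Input Alg : Type}

/-- The correct answers to the queries that `B` asks about the input `x`. -/
noncomputable def correctAnswer (B : AdviceAlgorithm k Input Alg) (x : Input) (i : ℕ) : Bool :=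
  open Classical in
  if h : i < k then decide (x ∈ B.query ⟨i, h⟩ fun j => correctAnswer B x j) else false
termination_by i
decreasing_by exact j.isLt

theorem exists_errors_eq_zero (B : AdviceAlgorithm k Input Alg) (x : Input) :
    ∃ w, B.errors x w = 0 := by
  classical
  refine ⟨fun i => B.correctAnswer x i, ?_⟩
  rw [errors, Finset.card_eq_zero, Finset.filter_eq_empty_iff]
  intro i _
  rw [not_not, correctAnswer, dif_pos i.isLt, decide_eq_true_iff]
  rfl

theorem exists_ratio_le_competitiveRatio (ratio : Alg → Input → ENNReal)
    (B : AdviceAlgorithm k Input Alg) (x : Input) :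
    ∃ w, ratio (B.select w) x ≤ B.competitiveRatio ratio 0 := by
  obtain ⟨w, hw⟩ := B.exists_errors_eq_zero x
  exact ⟨w, le_iSup_of_le x (le_iSup_of_le w (le_iSup_of_le hw.le le_rfl))⟩

end AdviceAlgorithm

open AdviceAlgorithm in
/-- If for every input one of `2 ^ k` algorithms has ratio at most `α`, then some algorithm with
unreliable advice of the stated size has competitive ratio at most `α`. -/
theorem exists_robust_algorithm {Input Alg : Type} (ratio : Alg → Input → ENNReal) {k l : ℕ} {c : ℝ}
    (hc : c ∈ Set.Ioo (0 : ℝ) (1 / 3)) (hl : adviceSize k c - 1 ≤ l) (alg : Fin (2 ^ k) → Alg)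
    (α : ENNReal) (halg : ∀ x, ∃ i, ratio (alg i) x ≤ α) :
    ∃ A : AdviceAlgorithm l Input Alg,
      ∀ η : ℕ, (η : ℝ) ≤ (1 / 3 - c) * l → A.competitiveRatio ratio η ≤ α := by
  obtain ⟨r, hr, hle, hcard⟩ := exists_code_parameters hc hl
  set E := ⌊(1 / 3 - c) * l⌋₊
  obtain ⟨T, hT1, hT2, hT3⟩ := Rubber.exists_words (zero_lt_one.trans (one_lt_growth hr))
    (growth_le_two r) (growth_pow_le hr) (l - (r + 1) * E)
  have hT : Fintype.card (Fin (2 ^ k)) ≤ Fintype.card T := by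
    rw [Fintype.card_fin, Fintype.card_coe]
    exact_mod_cast hcard.trans hT3
  obtain ⟨e⟩ := Function.Embedding.nonempty_of_card_le hT
  obtain ⟨send, decode, hcode⟩ := exists_feedback_code (l := l) (E := E) (by omega : 0 < r)
    (fun i => (e i : ℕ → Bool)) (fun i => hT1 _ (e i).2)
    (fun i j h => e.injective (Subtype.ext (hT2 _ (e i).2 _ (e j).2 h))) (by omega)
  choose f hf using halg
  refine ⟨⟨fun i h => {x | send i h (f x) = true}, fun w => alg (decode w)⟩, fun η hη => ?_⟩
  refine iSup_le fun x => iSup_le fun w => iSup_le fun hw => ?_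
  have : decode w = f x := by
    refine hcode (f x) w ((le_of_eq ?_).trans (hw.trans (Nat.le_floor hη)))
    unfold errors
    congr 1
    ext i
    simp only [Finset.mem_filter, Finset.mem_univ, true_and]
    exact not_congr Bool.eq_iff_iff
  simp only [this]
  exact hf x

/-! ### Time-series search -/

namespace PriceSequence

variable {m M : ℝ}

theorem price_le_maxPrice (σ : PriceSequence m M) (i : Fin (σ.last + 1)) :
    σ.price i ≤ σ.maxPrice := Finset.le_sup' _ (Finset.mem_univ i)

theorem exists_price_eq_maxPrice (σ : PriceSequence m M) : ∃ i, σ.price i = σ.maxPrice := by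
  obtain ⟨i, -, hi⟩ := Finset.exists_mem_eq_sup' Finset.univ_nonempty σ.price
  exact ⟨i, hi.symm⟩

theorem maxPrice_mem (σ : PriceSequence m M) : σ.maxPrice ∈ Set.Icc m M := by
  obtain ⟨i, hi⟩ := σ.exists_price_eq_maxPrice
  exact hi ▸ σ.price_mem i

theorem profit_mem (A : SellingRule) (σ : PriceSequence m M) : σ.profit A ∈ Set.Icc m M :=
  σ.price_mem _

theorem saleDay_spec (A : SellingRule) (σ : PriceSequence m M) :
    A (σ.saleDay A) (σ.history (σ.saleDay A)) = true ∨ σ.saleDay A = Fin.last σ.last := by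
  have h : σ.saleDay A ∈ Finset.univ.filter fun i : Fin (σ.last + 1) =>
      A i (σ.history i) = true ∨ i = Fin.last σ.last := Finset.min'_mem _ _
  exact (Finset.mem_filter.1 h).2

theorem saleDay_le {A : SellingRule} {σ : PriceSequence m M} {i : Fin (σ.last + 1)}
    (h : A i (σ.history i) = true) : σ.saleDay A ≤ i :=
  Finset.min'_le _ _ (Finset.mem_filter.2 ⟨Finset.mem_univ i, Or.inl h⟩)

end PriceSequence

/-- The rule that accepts the first price that is at least `v`. -/
noncomputable def reservationRule (v : ℝ) : SellingRule :=
  fun n h => decide (v ≤ h (Fin.last n))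

theorem PriceSequence.le_profit_reservationRule {m M v : ℝ} {σ : PriceSequence m M}
    (hv : v ≤ σ.maxPrice) : v ≤ σ.profit (reservationRule v) := by
  have hiff : ∀ i : Fin (σ.last + 1), reservationRule v i (σ.history i) = true ↔
      v ≤ σ.price i := fun i => decide_eq_true_iff
  obtain ⟨i, hi⟩ := σ.exists_price_eq_maxPrice
  rw [← hi] at hv
  rcases σ.saleDay_spec (reservationRule v) with h | h
  · exact (hiff _).1 h
  · have h1 := PriceSequence.saleDay_le ((hiff i).2 hv)
    rw [h] at h1
    have h2 : i = Fin.last σ.last := le_antisymm (Fin.le_last i) h1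
    rw [PriceSequence.profit, h, ← h2]
    exact hv

theorem exists_reservationRule_ratio_le {m M α : ℝ} {n : ℕ} (hm : 0 < m) (hn : 0 < n)
    (hα : m * α ^ (n + 1) = M) (hα0 : 0 < α) (σ : PriceSequence m M) :
    ∃ i : Fin n, timeSeriesRatio m M (reservationRule (m * α ^ (i + 1 : ℕ))) σ ≤
      ENNReal.ofReal α := by
  have hmax := σ.maxPrice_mem
  suffices h : ∃ i : Fin n,
      σ.maxPrice ≤ α * σ.profit (reservationRule (m * α ^ (i + 1 : ℕ))) by
    obtain ⟨i, hi⟩ := h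
    refine ⟨i, ENNReal.ofReal_le_ofReal ?_⟩
    rwa [div_le_iff₀ (hm.trans_le (σ.profit_mem _).1)]
  by_cases h1 : σ.maxPrice ≤ α * m
  · exact ⟨⟨0, hn⟩, h1.trans (mul_le_mul_of_nonneg_left (σ.profit_mem _).1 hα0.le)⟩
  · have hex : ∃ t : ℕ, σ.maxPrice ≤ m * α ^ (t + 1) := ⟨n, hα ▸ hmax.2⟩
    classical
    obtain ⟨t, ht⟩ : ∃ t, Nat.find hex = t + 1 := by
      refine Nat.exists_eq_succ_of_ne_zero fun h0 => h1 ?_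
      have := Nat.find_spec hex
      rw [h0, zero_add, pow_one, mul_comm] at this
      exact this
    have htn : t < n := by
      have := Nat.find_le (h := hex) (hα ▸ hmax.2 : σ.maxPrice ≤ m * α ^ (n + 1))
      omega
    have h2 := Nat.find_spec hex
    have h3 := Nat.find_min hex (show t < Nat.find hex by omega)
    rw [ht] at h2
    refine ⟨⟨t, htn⟩, ?_⟩
    have h4 := PriceSequence.le_profit_reservationRule (not_le.1 h3).le
    calc σ.maxPrice ≤ m * α ^ (t + 1 + 1) := h2
      _ = α * (m * α ^ (t + 1)) := by ring
      _ ≤ _ := mul_le_mul_of_nonneg_left h4 hα0.le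

/-- The prices `m * α, …, m * α ^ i`, followed by `m`. -/
def risingSequence {m M α : ℝ} {n : ℕ} (hm : 0 < m) (hα : m * α ^ (n + 1) = M) (h1 : 1 ≤ α)
    (i : Fin (n + 2)) : PriceSequence m M where
  last := i
  price j := if (j : ℕ) < i then m * α ^ (j + 1 : ℕ) else m
  price_mem j := by
    have h2 : ∀ t : ℕ, t ≤ n + 1 → m * α ^ t ∈ Set.Icc m M := fun t ht =>
      ⟨le_mul_of_one_le_right hm.le (one_le_pow₀ h1),
        hα ▸ mul_le_mul_of_nonneg_left (pow_le_pow_right₀ h1 ht) hm.le⟩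
    split
    · exact h2 _ (by omega)
    · simpa using h2 0 (by omega)

/-- A rule with ratio below `α` sells the rising sequence exactly at its maximum. -/
theorem saleDay_risingSequence {m M α : ℝ} {n : ℕ} (hm : 0 < m) (hα : m * α ^ (n + 1) = M)
    (h1 : 1 ≤ α) {A : SellingRule} (i : Fin (n + 1))
    (h : timeSeriesRatio m M A (risingSequence hm hα h1 i.succ) < ENNReal.ofReal α) :
    ((risingSequence hm hα h1 i.succ).saleDay A : ℕ) = i := by
  set σ := risingSequence hm hα h1 i.succ with hσ
  have hα0 : 0 < α := zero_lt_one.trans_le h1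
  have hlast : σ.last = i + 1 := by simp [hσ, risingSequence]
  have hprice : ∀ j : Fin (σ.last + 1),
      σ.price j = if (j : ℕ) < i + 1 then m * α ^ (j + 1 : ℕ) else m := fun j =>
    rfl
  have hmax : m * α ^ (i + 1 : ℕ) ≤ σ.maxPrice := by
    have := σ.price_le_maxPrice ⟨i, by omega⟩
    rwa [hprice, if_pos (Nat.lt_succ_self _)] at this
  rw [timeSeriesRatio, ENNReal.ofReal_lt_ofReal_iff hα0,
    div_lt_iff₀ (hm.trans_le (σ.profit_mem A).1)] at h
  have hprofit : m * α ^ (i : ℕ) < σ.profit A := by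
    refine lt_of_mul_lt_mul_left ?_ hα0.le
    calc α * (m * α ^ (i : ℕ)) = m * α ^ (i + 1 : ℕ) := by ring
      _ < _ := hmax.trans_lt h
  rw [PriceSequence.profit, hprice] at hprofit
  split at hprofit
  · rename_i h2
    by_contra hne
    have h3 := mul_le_mul_of_nonneg_left
      (pow_le_pow_right₀ h1 (show (σ.saleDay A : ℕ) + 1 ≤ i by omega)) hm.le
    linarith
  · have := le_mul_of_one_le_right hm.le (one_le_pow₀ h1 (n := (i : ℕ)))
    linarith

theorem history_risingSequence {m M α : ℝ} {n : ℕ} (hm : 0 < m) (hα : m * α ^ (n + 1) = M)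
    (h1 : 1 ≤ α) (i : Fin (n + 2)) (j : Fin ((i : ℕ) + 1)) (hj : (j : ℕ) < i) :
    (risingSequence hm hα h1 i).history j =
      fun t : Fin ((j : ℕ) + 1) => m * α ^ ((t : ℕ) + 1) := by
  funext t
  exact if_pos (show (t : ℕ) < i by omega)

theorem ofReal_le_competitiveRatio_timeSeries {m M α : ℝ} {k : ℕ} (hm : 0 < m)
    (hα : m * α ^ (2 ^ k + 1) = M) (h1 : 1 ≤ α)
    (B : AdviceAlgorithm k (PriceSequence m M) SellingRule) :
    ENNReal.ofReal α ≤ B.competitiveRatio (timeSeriesRatio m M) 0 := by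
  by_contra! hB
  choose w hw using fun i : Fin (2 ^ k + 1) => B.exists_ratio_le_competitiveRatio
    (timeSeriesRatio m M) (risingSequence hm hα h1 i.succ)
  obtain ⟨i, j, hij, hwij⟩ : ∃ i j, i < j ∧ w i = w j := by
    obtain ⟨i, j, hij, h⟩ := Fintype.exists_ne_map_eq_of_card_lt w (by simp)
    rcases lt_or_gt_of_ne hij with h' | h'
    · exact ⟨i, j, h', h⟩
    · exact ⟨j, i, h', h.symm⟩
  set A := B.select (w i) with hA
  have hi := saleDay_risingSequence hm hα h1 i ((hw i).trans_lt hB)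
  have hj := saleDay_risingSequence hm hα h1 j ((hw j).trans_lt hB)
  rw [← hwij, ← hA] at hj
  rw [← hA] at hi
  have haccept : A i (fun t => m * α ^ ((t : ℕ) + 1)) = true := by
    have h2 : (risingSequence hm hα h1 i.succ).saleDay A = (⟨i, by simp⟩ :
      Fin ((i.succ : ℕ) + 1)) := Fin.ext hi
    rcases (risingSequence hm hα h1 i.succ).saleDay_spec A with h3 | h3
    · rw [h2] at h3
      rwa [history_risingSequence hm hα h1 i.succ ⟨i, _⟩ (by simp)] at h3
    · have h4 := congrArg Fin.val h3
      rw [hi] at h4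
      simp [risingSequence] at h4
  have hle : (risingSequence hm hα h1 j.succ).saleDay A ≤
      (⟨i, by simp; omega⟩ : Fin ((j.succ : ℕ) + 1)) := by
    refine PriceSequence.saleDay_le ?_
    rw [history_risingSequence hm hα h1 j.succ ⟨i, _⟩ (by simp; omega)]
    exact haccept
  have : ((risingSequence hm hα h1 j.succ).saleDay A : ℕ) ≤ i := hle
  omega

/-! ### Online bidding -/

open Real in
/-- The logarithm of `(1 + θ) ^ (1 + θ) / θ ^ θ`. For `θ = 1 / n` this is the logarithm of the best
ratio of a portfolio of `n` bidding strategies. -/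
noncomputable def logBidRatio (θ : ℝ) : ℝ := (1 + θ) * log (1 + θ) - θ * log θ

namespace BiddingStrategy

/-- The sum of the first `j` bids. -/
noncomputable def total (X : BiddingStrategy) (j : ℕ) : ℝ := ∑ i ∈ Finset.range j, X.bid i

variable (X : BiddingStrategy)

theorem total_succ (j : ℕ) : X.total (j + 1) = X.total j + X.bid j :=
  Finset.sum_range_succ _ _

theorem total_mono : Monotone X.total :=
  monotone_nat_of_le_succ fun j => by rw [total_succ]; linarith [X.bid_pos j]

theorem bid_le_total (j : ℕ) : X.bid j ≤ X.total (j + 1) :=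
  Finset.single_le_sum (f := X.bid) (fun i _ => (X.bid_pos i).le) (Finset.self_mem_range_succ j)

theorem total_succ_pos (j : ℕ) : 0 < X.total (j + 1) := (X.bid_pos j).trans_le (X.bid_le_total j)

theorem mul_bid_zero_le_total (j : ℕ) : j * X.bid 0 ≤ X.total j := by
  have := Finset.card_nsmul_le_sum (Finset.range j) X.bid (X.bid 0)
    fun i _ => X.bid_strictMono.monotone (Nat.zero_le i)
  simpa [total] using this

theorem cost_le {u : ℝ} {j : ℕ} (h : u ≤ X.bid j) : X.cost u ≤ ENNReal.ofReal (X.total (j + 1)) := by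
  classical
  have hex : ∃ j, u ≤ X.bid j := ⟨j, h⟩
  rw [cost, dif_pos hex]
  exact ENNReal.ofReal_le_ofReal (X.total_mono (by simpa using ⟨j, le_rfl, h⟩))

theorem exists_bid_of_ratio_le {u : Set.Ici (1 : ℝ)} {ρ : ℝ} (hρ : 0 ≤ ρ)
    (h : biddingRatio X u ≤ ENNReal.ofReal ρ) :
    ∃ j, (u : ℝ) ≤ X.bid j ∧ X.total (j + 1) ≤ ρ * u := by
  classical
  have hu : (0 : ℝ) < u := zero_lt_one.trans_le u.2
  rw [biddingRatio, ENNReal.div_le_iff (by simpa using hu) ENNReal.ofReal_ne_top,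
    ← ENNReal.ofReal_mul hρ, cost] at h
  split at h
  · rename_i hex
    exact ⟨Nat.find hex, Nat.find_spec hex,
      (ENNReal.ofReal_le_ofReal_iff (mul_nonneg hρ hu.le)).1 h⟩
  · exact absurd h (by simp)

end BiddingStrategy

section BiddingLowerBound

open Real

theorem log_mul_div_le {θ z s x : ℝ} (hθ : 0 < θ) (hz : z ≤ logBidRatio θ) (hs : 0 < s)
    (hx : 0 < x) : z + log x - log (s + x) ≤ θ * (log (s + x) - log s) := by
  have hsx : 0 < s + x := by linarith
  have h1 : log (x / (s + x) * (1 + θ)) ≤ x / (s + x) * (1 + θ) - 1 :=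
    log_le_sub_one_of_pos (by positivity)
  have h2 : log (s / (s + x) * ((1 + θ) / θ)) ≤ s / (s + x) * ((1 + θ) / θ) - 1 :=
    log_le_sub_one_of_pos (by positivity)
  rw [log_mul (by positivity) (by positivity), log_div hx.ne' hsx.ne'] at h1
  rw [log_mul (by positivity) (by positivity), log_div hs.ne' hsx.ne',
    log_div (by positivity) hθ.ne'] at h2
  have h3 := mul_le_mul_of_nonneg_left h2 hθ.le
  have h4 : x / (s + x) * (1 + θ) - 1 + θ * (s / (s + x) * ((1 + θ) / θ) - 1) = 0 := by
    field_simp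
    ring
  unfold logBidRatio at hz
  linarith

theorem sum_covered_le (X : BiddingStrategy) {θ z : ℝ} (hθ : 0 < θ) (hz0 : 0 ≤ z)
    (hz : z ≤ logBidRatio θ) (J : ℕ) :
    ∑ j ∈ Finset.range (J + 1), max 0 (z + log (X.bid j) - log (X.total (j + 1))) ≤
      z + θ * (log (X.total (J + 1)) - log (X.bid 0)) := by
  induction J with
  | zero => simp [BiddingStrategy.total, hz0]
  | succ J ih =>
    rw [Finset.sum_range_succ]
    have h1 := log_mul_div_le hθ hz (X.total_succ_pos J) (X.bid_pos (J + 1))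
    rw [← X.total_succ] at h1
    have h2 : 0 ≤ θ * (log (X.total (J + 1 + 1)) - log (X.total (J + 1))) :=
      mul_nonneg hθ.le (sub_nonneg.2 (log_le_log (X.total_succ_pos J) (X.total_mono (by omega))))
    have h3 := max_le h2 h1
    linarith

theorem logBidRatio_lt {ι : Type*} [Fintype ι] (X : ι → BiddingStrategy) {θ z : ℝ} (hθ : 0 < θ)
    (hθ1 : Fintype.card ι * θ < 1)
    (hX : ∀ u : Set.Ici (1 : ℝ), ∃ i, biddingRatio (X i) u ≤ ENNReal.ofReal (exp z)) :
    logBidRatio θ < z := by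
  by_contra! hz
  have hcover : ∀ s : ℝ, 0 ≤ s → ∃ i j,
      s ≤ log ((X i).bid j) ∧ log ((X i).total (j + 1)) ≤ z + s := fun s hs => by
    obtain ⟨i, hi⟩ := hX ⟨exp s, one_le_exp hs⟩
    obtain ⟨j, h1, h2⟩ := (X i).exists_bid_of_ratio_le (exp_pos z).le hi
    rw [← exp_add] at h2
    exact ⟨i, j, (le_log_iff_exp_le ((X i).bid_pos j)).2 h1,
      (log_le_iff_le_exp ((X i).total_succ_pos j)).2 h2⟩
  have hz0 : 0 ≤ z := by
    obtain ⟨i, j, h1, h2⟩ := hcover 0 le_rfl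
    have := log_le_log ((X i).bid_pos j) ((X i).bid_le_total j)
    linarith
  set C : ι → ℝ := fun i => max 0 (z + θ * (z - log ((X i).bid 0))) with hC
  have hC0 : 0 ≤ ∑ i, C i := Finset.sum_nonneg fun i _ => le_max_left _ _
  have key : ∀ t : ℝ, 0 ≤ t → t ≤ ∑ i, C i + Fintype.card ι * θ * t := by
    intro t ht
    have hex : ∀ i, ∃ j, exp (z + t) < (X i).total (j + 1) := fun i => by
      obtain ⟨j, hj⟩ := exists_nat_gt (exp (z + t) / (X i).bid 0)
      rw [div_lt_iff₀ ((X i).bid_pos 0)] at hj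
      exact ⟨j, hj.trans_le (((X i).mul_bid_zero_le_total j).trans ((X i).total_mono j.le_succ))⟩
    classical
    set J : ι → ℕ := fun i => Nat.find (hex i) with hJ
    set f : ι → ℕ → ℝ := fun i j =>
      max 0 (z + log ((X i).bid j) - log ((X i).total (j + 1))) with hf
    have hsum : ∀ i, ∑ j ∈ Finset.range (J i), f i j ≤ C i + θ * t := fun i => by
      rcases Nat.eq_zero_or_eq_succ_pred (J i) with h | h
      · rw [h, Finset.sum_range_zero]
        exact add_nonneg (le_max_left _ _) (mul_nonneg hθ.le ht)
      · have h1 := Nat.find_min (hex i) (show (J i).pred < Nat.find (hex i) by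
          change (J i).pred < J i
          omega)
        rw [not_lt, ← log_le_iff_le_exp ((X i).total_succ_pos _)] at h1
        rw [h]
        refine (sum_covered_le (X i) hθ hz0 hz _).trans ?_
        have h2 : z + θ * (z - log ((X i).bid 0)) ≤ C i := le_max_right _ _
        have h3 := mul_le_mul_of_nonneg_left h1 hθ.le
        linarith
    have hsub : Set.Icc 0 t ⊆ ⋃ i ∈ (Finset.univ : Finset ι), ⋃ j ∈ Finset.range (J i),
        Set.Icc (log ((X i).total (j + 1)) - z) (log ((X i).bid j)) := by
      intro s hs
      obtain ⟨i, j, h1, h2⟩ := hcover s hs.1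
      simp only [Set.mem_iUnion, Finset.mem_range, Finset.mem_univ]
      refine ⟨i, trivial, j, ?_, by linarith, h1⟩
      by_contra! hj
      have h3 := (Nat.find_spec (hex i)).trans_le ((X i).total_mono (Nat.succ_le_succ hj))
      rw [← lt_log_iff_exp_lt ((X i).total_succ_pos _)] at h3
      linarith [hs.2]
    have hvol : ENNReal.ofReal t ≤ ENNReal.ofReal (∑ i, ∑ j ∈ Finset.range (J i), f i j) := by
      have h0 : ∀ i j, 0 ≤ f i j := fun i j => le_max_left _ _
      rw [ENNReal.ofReal_sum_of_nonneg fun i _ => Finset.sum_nonneg fun j _ => h0 i j]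
      calc ENNReal.ofReal t = MeasureTheory.volume (Set.Icc 0 t) := by simp
        _ ≤ _ := MeasureTheory.measure_mono hsub
        _ ≤ _ := MeasureTheory.measure_biUnion_finset_le _ _
        _ ≤ _ := by
          refine Finset.sum_le_sum fun i _ => (MeasureTheory.measure_biUnion_finset_le _ _).trans ?_
          rw [ENNReal.ofReal_sum_of_nonneg fun j _ => h0 i j]
          refine Finset.sum_le_sum fun j _ => ?_
          rw [Real.volume_Icc]
          refine ENNReal.ofReal_le_ofReal (le_trans (le_of_eq ?_) (le_max_right _ _))
          ring
    rw [ENNReal.ofReal_le_ofReal_iff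
      (Finset.sum_nonneg fun i _ => Finset.sum_nonneg fun j _ => le_max_left _ _)] at hvol
    refine hvol.trans ((Finset.sum_le_sum fun i _ => hsum i).trans (le_of_eq ?_))
    rw [Finset.sum_add_distrib, Finset.sum_const, Finset.card_univ, nsmul_eq_mul, mul_assoc]
  have hpos : 0 < 1 - Fintype.card ι * θ := by linarith
  have h := key ((∑ i, C i + 1) / (1 - Fintype.card ι * θ)) (by positivity)
  have h' : (1 - Fintype.card ι * θ) * ((∑ i, C i + 1) / (1 - Fintype.card ι * θ)) =
    ∑ i, C i + 1 := mul_div_cancel₀ _ hpos.ne'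
  linarith

theorem logBidRatio_inv_card_le {ι : Type*} [Fintype ι] [Nonempty ι] (X : ι → BiddingStrategy)
    {z : ℝ} (hX : ∀ u : Set.Ici (1 : ℝ), ∃ i, biddingRatio (X i) u ≤ ENNReal.ofReal (exp z)) :
    logBidRatio (1 / Fintype.card ι) ≤ z := by
  have hn : (0 : ℝ) < Fintype.card ι := by exact_mod_cast Fintype.card_pos
  have hn' : (0 : ℝ) < 1 / Fintype.card ι := by positivity
  by_contra! hz
  have hcont : ContinuousAt logBidRatio (1 / Fintype.card ι) := by
    unfold logBidRatio
    refine ContinuousAt.sub (ContinuousAt.mul (by fun_prop) (ContinuousAt.log (by fun_prop) ?_))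
      (ContinuousAt.mul (by fun_prop) (ContinuousAt.log (by fun_prop) ?_)) <;> positivity
  have h1 : ∀ᶠ θ in nhdsWithin (1 / (Fintype.card ι : ℝ)) (Set.Iio (1 / Fintype.card ι)),
      z < logBidRatio θ ∧ 0 < θ :=
    Filter.Eventually.filter_mono nhdsWithin_le_nhds
      ((hcont.eventually (lt_mem_nhds hz)).and (lt_mem_nhds hn'))
  obtain ⟨θ, ⟨h2, h3⟩, h4⟩ := (h1.and self_mem_nhdsWithin).exists
  refine lt_asymm h2 (logBidRatio_lt X h3 ?_ hX)
  rw [lt_div_iff₀ hn] at h4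
  linarith

theorem le_competitiveRatio_bidding {k : ℕ}
    (B : AdviceAlgorithm k (Set.Ici (1 : ℝ)) BiddingStrategy) :
    ENNReal.ofReal (exp (logBidRatio (1 / 2 ^ k))) ≤ B.competitiveRatio biddingRatio 0 := by
  have hB := B.exists_ratio_le_competitiveRatio biddingRatio
  generalize B.competitiveRatio biddingRatio 0 = R at hB ⊢
  rcases eq_or_ne R ⊤ with rfl | hR
  · exact le_top
  rw [ENNReal.ofReal_le_iff_le_toReal hR]
  rcases (ENNReal.toReal_nonneg (a := R)).eq_or_lt with h0 | h0
  · obtain ⟨w, hw⟩ := hB ⟨1, Set.self_mem_Ici⟩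
    rw [← ENNReal.ofReal_toReal hR] at hw
    obtain ⟨j, -, h⟩ := (B.select w).exists_bid_of_ratio_le ENNReal.toReal_nonneg hw
    rw [← h0, zero_mul] at h
    exact absurd ((B.select w).total_succ_pos j) h.not_gt
  · rw [← le_log_iff_exp_le h0]
    have := logBidRatio_inv_card_le B.select (z := log R.toReal) fun u => by
      rw [exp_log h0, ENNReal.ofReal_toReal hR]
      exact hB u
    simpa using this

end BiddingLowerBound

/-- The bids `β ^ i, β ^ (n + i), β ^ (2 * n + i), …`. -/
def geometricBids {β : ℝ} (hβ : 1 < β) {n : ℕ} (hn : 0 < n) (i : ℕ) : BiddingStrategy where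
  bid j := β ^ (n * j + i)
  bid_pos _ := pow_pos (zero_lt_one.trans hβ) _
  bid_strictMono := fun _ _ hab =>
    pow_lt_pow_right₀ hβ (Nat.add_lt_add_right (Nat.mul_lt_mul_of_pos_left hab hn) i)

theorem exists_geometricBids_ratio_le {β : ℝ} (hβ : 1 < β) {n : ℕ} (hn : 0 < n)
    (hβn : β ^ n = n + 1) (u : Set.Ici (1 : ℝ)) :
    ∃ i : Fin n, biddingRatio (geometricBids hβ hn i) u ≤ ENNReal.ofReal (β * (n + 1) / n) := by
  classical
  have hβ0 : 0 < β := zero_lt_one.trans hβ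
  have hu : (0 : ℝ) < u := zero_lt_one.trans_le u.2
  have hn' : (0 : ℝ) < n := by exact_mod_cast hn
  have hex : ∃ t : ℕ, (u : ℝ) ≤ β ^ t := pow_unbounded_of_one_lt (u : ℝ) hβ |>.imp fun _ h => h.le
  set t := Nat.find hex
  have h1 : (u : ℝ) ≤ β ^ t := Nat.find_spec hex
  have h2 : β ^ t ≤ β * u := by
    rcases Nat.eq_zero_or_eq_succ_pred t with h | h
    · rw [h, pow_zero]
      exact (one_le_mul_of_one_le_of_one_le hβ.le u.2)
    · have := Nat.find_min hex (show t.pred < Nat.find hex by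
        change t.pred < t
        omega)
      rw [h, Nat.succ_eq_add_one, pow_succ, mul_comm]
      exact mul_le_mul_of_nonneg_left (not_le.1 this).le hβ0.le
  set X := geometricBids hβ hn (t % n) with hX
  refine ⟨⟨t % n, Nat.mod_lt t hn⟩, ?_⟩
  have hbid : X.bid (t / n) = β ^ t := by
    change β ^ (n * (t / n) + t % n) = β ^ t
    rw [Nat.div_add_mod]
  have htotal : X.total (t / n + 1) ≤ β * (n + 1) / n * u := by
    have hterm : ∀ j, X.bid j = β ^ (t % n) * (n + 1 : ℝ) ^ j := fun j => by
      change β ^ (n * j + t % n) = _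
      rw [pow_add, pow_mul, hβn, mul_comm]
    have hgeom : X.total (t / n + 1) ≤ β ^ t * (n + 1) / n := by
      rw [← hbid, hterm, BiddingStrategy.total, Finset.sum_congr rfl fun j _ => hterm j,
        ← Finset.mul_sum, geom_sum_eq (by linarith), add_sub_cancel_right, pow_succ, mul_assoc,
        mul_div_assoc]
      refine mul_le_mul_of_nonneg_left ?_ (by positivity)
      exact div_le_div_of_nonneg_right (by linarith) hn'.le
    calc X.total (t / n + 1) ≤ β ^ t * (n + 1) / n := hgeom
      _ ≤ β * u * (n + 1) / n := by gcongr
      _ = _ := by ring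
  rw [biddingRatio, ENNReal.div_le_iff (by simpa using hu) ENNReal.ofReal_ne_top,
    ← ENNReal.ofReal_mul (by positivity)]
  exact (X.cost_le (hbid ▸ h1)).trans (ENNReal.ofReal_le_ofReal htotal)

open Real in
theorem exp_logBidRatio_inv {n : ℕ} (hn : 0 < n) :
    exp (logBidRatio (1 / n)) = ((n : ℝ) + 1) ^ (1 / (n : ℝ)) * (n + 1) / n := by
  have hn' : (0 : ℝ) < n := by exact_mod_cast hn
  rw [← exp_log (show 0 < ((n : ℝ) + 1) ^ (1 / (n : ℝ)) * (n + 1) / n by positivity)]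
  congr 1
  rw [log_div (by positivity) (by positivity), log_mul (by positivity) (by positivity),
    log_rpow (by positivity), logBidRatio, show 1 + 1 / (n : ℝ) = (n + 1) / n by field_simp,
    log_div (by positivity) (by positivity), log_div (by positivity) (by positivity), log_one]
  field_simp
  ring

end ImperfectAdvice

theorem mainTheorem10 :
    ∃ K : ℕ, ∀ k : ℕ, K ≤ k → ∀ c ∈ Set.Ioo (0 : ℝ) (1 / 3),
      ∀ l : ℕ, (l = ⌊ImperfectAdvice.adviceSize k c⌋₊ ∨ l = ⌈ImperfectAdvice.adviceSize k c⌉₊) →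
        (∀ m M : ℝ, 0 < m → m ≤ M →
          ∃ A : ImperfectAdvice.AdviceAlgorithm l
              (ImperfectAdvice.PriceSequence m M) ImperfectAdvice.SellingRule,
            ∀ η : ℕ, (η : ℝ) ≤ (1 / 3 - c) * l →
              ∀ B : ImperfectAdvice.AdviceAlgorithm k
                  (ImperfectAdvice.PriceSequence m M) ImperfectAdvice.SellingRule,
                A.competitiveRatio (ImperfectAdvice.timeSeriesRatio m M) η ≤
                  B.competitiveRatio (ImperfectAdvice.timeSeriesRatio m M) 0) ∧
        (∃ A : ImperfectAdvice.AdviceAlgorithm l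
            (Set.Ici (1 : ℝ)) ImperfectAdvice.BiddingStrategy,
          ∀ η : ℕ, (η : ℝ) ≤ (1 / 3 - c) * l →
            ∀ B : ImperfectAdvice.AdviceAlgorithm k
                (Set.Ici (1 : ℝ)) ImperfectAdvice.BiddingStrategy,
              A.competitiveRatio ImperfectAdvice.biddingRatio η ≤
                B.competitiveRatio ImperfectAdvice.biddingRatio 0) := by
  refine ⟨0, fun k _ c hc l hl => ?_⟩
  have hl' : ImperfectAdvice.adviceSize k c - 1 ≤ l := by
    rcases hl with rfl | rfl
    · exact (Nat.sub_one_lt_floor _).le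
    · exact (sub_le_self _ zero_le_one).trans (Nat.le_ceil _)
  have hn : 0 < 2 ^ k := by positivity
  constructor
  · intro m M hm hmM
    set α : ℝ := (M / m) ^ (1 / ((2 ^ k + 1 : ℕ) : ℝ)) with hα_def
    have hMm : 1 ≤ M / m := (one_le_div hm).2 hmM
    have hα1 : 1 ≤ α := Real.one_le_rpow hMm (by positivity)
    have hα : m * α ^ (2 ^ k + 1) = M := by
      rw [hα_def, one_div, Real.rpow_inv_natCast_pow (by linarith) (by omega),
        mul_div_cancel₀ _ hm.ne']
    obtain ⟨A, hA⟩ := ImperfectAdvice.exists_robust_algorithm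
      (ImperfectAdvice.timeSeriesRatio m M) hc hl' _ _
      (ImperfectAdvice.exists_reservationRule_ratio_le hm hn hα (by linarith))
    exact ⟨A, fun η hη B => (hA η hη).trans
      (ImperfectAdvice.ofReal_le_competitiveRatio_timeSeries hm hα hα1 B)⟩
  · have hn1 : (1 : ℝ) < ((2 ^ k : ℕ) : ℝ) + 1 := by
      have : (0 : ℝ) < ((2 ^ k : ℕ) : ℝ) := by exact_mod_cast hn
      linarith
    have hβ : 1 < (((2 ^ k : ℕ) : ℝ) + 1) ^ (1 / ((2 ^ k : ℕ) : ℝ)) :=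
      Real.one_lt_rpow hn1 (by positivity)
    have hβn : ((((2 ^ k : ℕ) : ℝ) + 1) ^ (1 / ((2 ^ k : ℕ) : ℝ))) ^ (2 ^ k) =
        ((2 ^ k : ℕ) : ℝ) + 1 := by
      rw [one_div, Real.rpow_inv_natCast_pow (by linarith) hn.ne']
    obtain ⟨A, hA⟩ := ImperfectAdvice.exists_robust_algorithm ImperfectAdvice.biddingRatio hc hl' _ _
      (ImperfectAdvice.exists_geometricBids_ratio_le hβ hn hβn)
    refine ⟨A, fun η hη B => (hA η hη).trans ?_⟩
    rw [← ImperfectAdvice.exp_logBidRatio_inv hn]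
    have := ImperfectAdvice.le_competitiveRatio_bidding B
    push_cast
    exact this
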